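/- A represented space is a set $X$ with a partial surjection $\delta_X : \subseteq \mathbb{N}^{\mathbb{N}} \to X$; $p$ is a name of $x$ if $\delta_X(p) = x$. A map between represented spaces is computable (respectively continuously realisable) if some computable (respectively continuous) partial function on $\mathbb{N}^{\mathbb{N}}$ maps names of each argument to names of its value, and $\cong$ denotes isomorphism by computable maps. $\mathbb{N}$ is represented by $p \mapsto p(0)$, and Sierpinski space $\mathbb{S} = \{\top, \bot\}$ is represented so that $0^\omega$ is the only name of $\bot$ and all other sequences are names of $\top$. A subset of $X$ is open if its characteristic function $X \to \mathbb{S}$ is continuously realisable; the space $\mathcal{O}(X)$ of open subsets of $X$ is identified with the function space $\mathbb{S}^X$, in which a name of a function is a code of a continuous realiser of it. A represented space $X$ is - computably overt if the map $\mathcal{O}(X) \to \mathbb{S}$ with value $\top$ exactly on the non-empty open sets is computable; - computably separable if there is a computable map $\mathbb{N} \to X$ whose range meets every non-empty open subset of $X$; - computably Quasi-Polish if it is computably overt and there is a computably enumerable transitive relation $\ll$ on $\mathbb{N}$ such that $X$ is isomorphic to the space of ideals of $\ll$ (non-empty, downwards closed, upwards directed subsets of $\mathbb{N}$, where $p$ is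 a name of $I$ if and only if $I = \{p(k) \mid k \in \mathbb{N}\}$); - a complete computable metric space if there is a computable pseudometric $d : \mathbb{N} \times \mathbb{N} \to \mathbb{R}$ such that $X$ is isomorphic to the Cauchy completion of $(\mathbb{N}, d)$, where $p$ is a name of $x$ if and only if $d(p(n), x) < 2^{-n}$ for all $n$. For $A \subseteq \mathbb{N}$ let $S_A = \{(n, \top) \mid n \in A\} \cup \{(n, \bot) \mid n \notin A\}$, regarded as a subspace of the product of represented spaces $\mathbb{N} \times \mathbb{S}$. **Proposition.** For every $A \subseteq \mathbb{N}$ the following are equivalent: 1. $S_A \cong \mathbb{N}$ (computably isomorphic). 2. $S_A$ is a complete computable metric space. 3. $S_A$ is computably Quasi-Polish. 4. $S_A$ is computably separable. 5. $S_A$ is computably overt. 6. $A$ is computably enumerable. -/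

import Mathlib

/-! ### Oracle machines and partial continuous functions on Baire space -/

/-- The length `j` initial segment of `p`, as a list. -/
def oraclePrefix (p : ℕ → ℕ) (j : ℕ) : List ℕ := (List.range j).map p

/-- `oracleEval e p n` is the output of the oracle machine with index `e`, oracle `p` and input `n`.
The machine runs the program with index `e` on pairs consisting of a finite initial segment of the
oracle and the input, for all lengths `j` of the segment and all step bounds `s` in dovetailed
order, and outputs the result of the first of these runs that halts. Every oracle Turing machine
arises in this way (simulate it on the given segment, and diverge on a query beyond it). -/
def oracleEval (e : ℕ) (p : ℕ → ℕ) (n : ℕ) : Part ℕ :=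
  Nat.rfindOpt fun m =>
    Nat.Partrec.Code.evaln m.unpair.2 (Nat.Partrec.Code.ofNatCode e)
      (Nat.pair (Encodable.encode (oraclePrefix p m.unpair.1)) n)

/-- The machine with index `e` maps the point `p` of Baire space to the point `r`. For fixed `e`
this is the graph of a partial computable function on Baire space. -/
def OracleMaps (e : ℕ) (p r : ℕ → ℕ) : Prop := ∀ n, r n ∈ oracleEval e p n

/-- The pair `⟨p, q⟩`, with `p` at the even and `q` at the odd positions. -/
def joinSeq (p q : ℕ → ℕ) (n : ℕ) : ℕ := if n % 2 = 0 then p (n / 2) else q (n / 2)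

/-- The partial continuous function coded by `c` maps `p` to `r`: the value `c 0` is the index of a
machine, and `n ↦ c (n + 1)` is an oracle that this machine has access to, in addition to the
argument `p`. -/
def CodedMaps (c p r : ℕ → ℕ) : Prop := OracleMaps (c 0) (joinSeq (fun n => c (n + 1)) p) r

/-! ### Represented spaces -/

/-- A represented space: a set with a partial surjection from Baire space onto it, given by its
graph; `IsName p x` says that `p` is a name of the point `x`. -/
structure RepresentedSpace where
  /-- the underlying set -/
  Pt : Type
  /-- the graph of the representation -/
  IsName : (ℕ → ℕ) → Pt → Prop
  /-- the representation is single-valued -/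
  unique : ∀ p x y, IsName p x → IsName p y → x = y
  /-- the representation is surjective -/
  surj : ∀ x, ∃ p, IsName p x

namespace RepresentedSpace

/-- A map between represented spaces is computable if it has a computable realiser. -/
def IsComputableMap (X Y : RepresentedSpace) (f : X.Pt → Y.Pt) : Prop :=
  ∃ e : ℕ, ∀ p x, X.IsName p x → ∃ r, OracleMaps e p r ∧ Y.IsName r (f x)

/-- Computable isomorphism of represented spaces. -/
def Iso (X Y : RepresentedSpace) : Prop :=
  ∃ f : X.Pt ≃ Y.Pt, IsComputableMap X Y f ∧ IsComputableMap Y X f.symm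

/-- `c` codes a realiser of `f`. -/
def CodesRealiser (X Y : RepresentedSpace) (c : ℕ → ℕ) (f : X.Pt → Y.Pt) : Prop :=
  ∀ p x, X.IsName p x → ∃ r, CodedMaps c p r ∧ Y.IsName r (f x)

/-- The function space of the continuously realisable maps from `X` to `Y`; a name of a map is a
code of a realiser of it. -/
def exponential (X Y : RepresentedSpace) : RepresentedSpace where
  Pt := {f : X.Pt → Y.Pt // ∃ c, CodesRealiser X Y c f}
  IsName c f := CodesRealiser X Y c f.1
  unique := by
    intro c f g hf hg
    apply Subtype.ext
    funext x
    obtain ⟨p, hp⟩ := X.surj x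
    obtain ⟨r, hr, hrf⟩ := hf p x hp
    obtain ⟨r', hr', hrg⟩ := hg p x hp
    have h : r = r' := funext fun n => Part.mem_unique (hr n) (hr' n)
    subst h
    exact Y.unique r _ _ hrf hrg
  surj f := f.2

/-- The natural numbers; `p` is a name of `p 0`. -/
def natSpace : RepresentedSpace where
  Pt := ℕ
  IsName p n := p 0 = n
  unique := by
    intro p x y hx hy
    exact hx.symm.trans hy
  surj n := ⟨fun _ => n, rfl⟩

/-- Sierpinski space. The point `⊤` is `True` and the point `⊥` is `False`; the zero sequence is
the only name of `⊥`, and every other sequence is a name of `⊤`. -/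
def sierpinski : RepresentedSpace where
  Pt := Prop
  IsName p b := b ↔ ∃ k, p k ≠ 0
  unique := by
    intro p x y hx hy
    exact propext (hx.trans hy.symm)
  surj b := by
    by_cases hb : b
    · exact ⟨fun _ => 1, by simp [hb]⟩
    · exact ⟨fun _ => 0, by simp [hb]⟩

/-- The product of represented spaces. -/
def prod (X Y : RepresentedSpace) : RepresentedSpace where
  Pt := X.Pt × Y.Pt
  IsName p z := X.IsName (fun n => p (2 * n)) z.1 ∧ Y.IsName (fun n => p (2 * n + 1)) z.2
  unique := by
    intro p x y hx hy
    exact Prod.ext (X.unique _ _ _ hx.1 hy.1) (Y.unique _ _ _ hx.2 hy.2)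
  surj := by
    intro z
    obtain ⟨p, hp⟩ := X.surj z.1
    obtain ⟨q, hq⟩ := Y.surj z.2
    refine ⟨joinSeq p q, ?_, ?_⟩
    · have h : (fun n => joinSeq p q (2 * n)) = p := by
        funext n
        simp [joinSeq]
      rw [h]
      exact hp
    · have h : (fun n => joinSeq p q (2 * n + 1)) = q := by
        funext n
        have h1 : (2 * n + 1) % 2 = 1 := by omega
        have h2 : (2 * n + 1) / 2 = n := by omega
        simp [joinSeq, h1, h2]
      rw [h]
      exact hq

/-- A subset of a represented space as a represented space, with the restricted representation. -/
def subspace (X : RepresentedSpace) (S : Set X.Pt) : RepresentedSpace where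
  Pt := {x : X.Pt // x ∈ S}
  IsName p x := X.IsName p x.1
  unique := by
    intro p x y hx hy
    exact Subtype.ext (X.unique p _ _ hx hy)
  surj x := X.surj x.1

/-! ### Open sets, overtness, separability -/

/-- The space of open subsets of `X`: an open set is identified with its characteristic function
into Sierpinski space. -/
def opens (X : RepresentedSpace) : RepresentedSpace := exponential X sierpinski

/-- `x` is an element of the open set `U`. -/
def MemOpen {X : RepresentedSpace} (x : X.Pt) (U : (opens X).Pt) : Prop := U.1 x

/-- `X` is computably overt: non-emptiness of open subsets of `X` is semidecidable. -/
def IsOvert (X : RepresentedSpace) : Prop :=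
  IsComputableMap (opens X) sierpinski fun U => ∃ x : X.Pt, MemOpen x U

/-- `X` is computably separable: it has a computable dense sequence. -/
def IsComputablySeparable (X : RepresentedSpace) : Prop :=
  ∃ s : ℕ → X.Pt, IsComputableMap natSpace X s ∧
    ∀ U : (opens X).Pt, (∃ x : X.Pt, MemOpen x U) → ∃ n : ℕ, MemOpen (s n) U

/-! ### Computably Quasi-Polish spaces -/

/-- `I` is an ideal of the relation `R` on the natural numbers. -/
def IsIdeal (R : ℕ → ℕ → Prop) (I : Set ℕ) : Prop :=
  I.Nonempty ∧ (∀ x, ∀ y ∈ I, R x y → x ∈ I) ∧ ∀ x ∈ I, ∀ y ∈ I, ∃ z ∈ I, R x z ∧ R y z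

/-- The space of ideals of `R`; a name of an ideal is an enumeration of it. -/
def idealSpace (R : ℕ → ℕ → Prop) : RepresentedSpace where
  Pt := {I : Set ℕ // IsIdeal R I}
  IsName p I := I.1 = Set.range p
  unique := by
    intro p x y hx hy
    exact Subtype.ext (hx.trans hy.symm)
  surj I := (Set.to_countable I.1).exists_eq_range I.2.1

/-- `X` is isomorphic to the space of ideals of a c.e. transitive relation. -/
def IsPrecomputablyQuasiPolish (X : RepresentedSpace) : Prop :=
  ∃ R : ℕ → ℕ → Prop, (∀ x y z, R x y → R y z → R x z) ∧
    REPred (fun z : ℕ × ℕ => R z.1 z.2) ∧ Iso X (idealSpace R)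

/-- `X` is computably Quasi-Polish: precomputably Quasi-Polish and computably overt. -/
def IsComputablyQuasiPolish (X : RepresentedSpace) : Prop :=
  IsPrecomputablyQuasiPolish X ∧ IsOvert X

/-! ### Complete computable metric spaces -/

/-- The rational number with code `n`: `(a - b) / (c + 1)` for `n` the code of `((a, b), c)`. -/
def ratOfNat (n : ℕ) : ℚ :=
  ((n.unpair.1.unpair.1 : ℚ) - (n.unpair.1.unpair.2 : ℚ)) / ((n.unpair.2 : ℚ) + 1)

theorem ratOfNat_surjective : Function.Surjective ratOfNat := by
  intro q
  refine ⟨Nat.pair (Nat.pair q.num.toNat (-q.num).toNat) (q.den - 1), ?_⟩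
  have hd : ((q.den - 1 : ℕ) : ℚ) + 1 = q.den := by
    have h := q.den_pos
    exact_mod_cast (by omega : q.den - 1 + 1 = q.den)
  have hn : ((q.num.toNat : ℚ) - ((-q.num).toNat : ℚ)) = q.num := by
    have h : ((q.num.toNat : ℤ) - ((-q.num).toNat : ℤ)) = q.num := by omega
    exact_mod_cast h
  simp only [ratOfNat, Nat.unpair_pair]
  rw [hd, hn, Rat.num_div_den]

/-- The real numbers; a name of `x` is a sequence of rationals converging rapidly to `x`. -/
def realSpace : RepresentedSpace where
  Pt := ℝ
  IsName p x := ∀ n : ℕ, |(ratOfNat (p n) : ℝ) - x| < (1 / 2) ^ n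
  unique := by
    intro p x y hx hy
    have h0 : Filter.Tendsto (fun n : ℕ => ((1 : ℝ) / 2) ^ n) Filter.atTop (nhds 0) :=
      tendsto_pow_atTop_nhds_zero_of_lt_one (by norm_num) (by norm_num)
    have h : ∀ z : ℝ, (∀ n : ℕ, |(ratOfNat (p n) : ℝ) - z| < (1 / 2) ^ n) →
        Filter.Tendsto (fun n => (ratOfNat (p n) : ℝ)) Filter.atTop (nhds z) := by
      intro z hz
      rw [tendsto_iff_dist_tendsto_zero]
      refine squeeze_zero (fun _ => dist_nonneg) (fun n => ?_) h0
      rw [Real.dist_eq]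
      exact (hz n).le
    exact tendsto_nhds_unique (h x hx) (h y hy)
  surj := by
    intro x
    have h : ∀ n : ℕ, ∃ m : ℕ, |(ratOfNat m : ℝ) - x| < (1 / 2) ^ n := by
      intro n
      obtain ⟨q, hq⟩ := exists_rat_near x (show (0 : ℝ) < (1 / 2) ^ n by positivity)
      obtain ⟨m, rfl⟩ := ratOfNat_surjective q
      exact ⟨m, by rwa [abs_sub_comm]⟩
    choose p hp using h
    exact ⟨p, hp⟩

/-- The completion of the pseudometric space `E`, represented by means of a dense sequence `a`:
a name of `x` is a sequence `p` such that `a (p n)` has distance less than `2⁻ⁿ` from `x`. -/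
def completionSpace (E : Type) [PseudoMetricSpace E] (a : ℕ → E) (ha : DenseRange a) :
    RepresentedSpace where
  Pt := UniformSpace.Completion E
  IsName p x := ∀ n : ℕ, dist (a (p n) : UniformSpace.Completion E) x < (1 / 2) ^ n
  unique := by
    intro p x y hx hy
    have h0 : Filter.Tendsto (fun n : ℕ => ((1 : ℝ) / 2) ^ n) Filter.atTop (nhds 0) :=
      tendsto_pow_atTop_nhds_zero_of_lt_one (by norm_num) (by norm_num)
    have h : ∀ z : UniformSpace.Completion E,
        (∀ n : ℕ, dist (a (p n) : UniformSpace.Completion E) z < (1 / 2) ^ n) →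
        Filter.Tendsto (fun n => (a (p n) : UniformSpace.Completion E)) Filter.atTop
          (nhds z) := by
      intro z hz
      rw [tendsto_iff_dist_tendsto_zero]
      exact squeeze_zero (fun _ => dist_nonneg) (fun n => (hz n).le) h0
    exact tendsto_nhds_unique (h x hx) (h y hy)
  surj := by
    intro x
    have hd : DenseRange fun m => (a m : UniformSpace.Completion E) :=
      UniformSpace.Completion.denseRange_coe.comp ha (UniformSpace.Completion.continuous_coe E)
    have h : ∀ n : ℕ, ∃ m : ℕ, dist (a m : UniformSpace.Completion E) x < (1 / 2) ^ n := by
      intro n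
      obtain ⟨m, hm⟩ := hd.exists_dist_lt x (show (0 : ℝ) < (1 / 2) ^ n by positivity)
      exact ⟨m, by rwa [dist_comm]⟩
    choose p hp using h
    exact ⟨p, hp⟩

/-- The Cauchy completion of the natural numbers with the pseudometric `d`. -/
def metricSpaceOf (d : PseudoMetricSpace ℕ) : RepresentedSpace :=
  @completionSpace ℕ d id (@Function.Surjective.denseRange ℕ d.toUniformSpace.toTopologicalSpace ℕ
    id Function.surjective_id)

/-- `X` is a complete computable metric space: it is isomorphic to the Cauchy completion of the
natural numbers with a computable pseudometric. -/
def IsCompleteComputableMetricSpace (X : RepresentedSpace) : Prop :=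
  ∃ d : PseudoMetricSpace ℕ,
    IsComputableMap (prod natSpace natSpace) realSpace (fun z : ℕ × ℕ => d.dist z.1 z.2) ∧
      Iso X (metricSpaceOf d)

/-! ### The spaces under consideration -/

/-- The subspace `{(n, ⊤) | n ∈ A} ∪ {(n, ⊥) | n ∉ A}` of the product of the natural numbers and
Sierpinski space. -/
def spaceS (A : Set ℕ) : RepresentedSpace :=
  subspace (prod natSpace sierpinski)
    ({z : ℕ × Prop | ∃ n, n ∈ A ∧ z = (n, True)} ∪ {z : ℕ × Prop | ∃ n, n ∉ A ∧ z = (n, False)})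

end RepresentedSpace

/-! ### Semidecidable predicates as projections of primitive recursive ones -/

/-! A name of the point over `n` consists of `n` and a sequence that has a nonzero entry exactly
when `n ∈ A`. Hence producing names of all points computably is the same as enumerating `A`. If `A`
is c.e., a name of the point over `n` is computable uniformly in `n`, so the space is a copy of the
discrete space ℕ, which is a complete metric space and a space of ideals (`iso_spaceS_of_rePred`);
searching through these names gives overtness (`isOvert_of_rePred`). Conversely, a computable
sequence hitting every point enumerates `A` (`rePred_of_computable_sequence`). Separability gives
one because every singleton is open; a computable metric gives one because its dense sequence,
pulled back along the isomorphism, meets every fiber. Overtness is applied instead to the open set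
that is the point over `n` if `n ∈ A` and empty otherwise: a code of it is computable from `n`
without deciding `n ∈ A`. -/

theorem REPred.exists_primrec {p : ℕ → Prop} (hp : REPred p) :
    ∃ Q : ℕ → ℕ → Bool, Primrec₂ Q ∧ ∀ n, p n ↔ ∃ s, Q n s = true := by
  obtain ⟨c, hc⟩ := Nat.Partrec.Code.exists_code.1 hp
  refine ⟨fun n s => (Nat.Partrec.Code.evaln s c n).isSome, ?_, fun n => ?_⟩
  · exact Primrec.option_isSome.comp (Nat.Partrec.Code.primrec_evaln.comp
      ((Primrec.snd.pair (Primrec.const c)).pair Primrec.fst))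
  · have h : (c.eval n).Dom ↔ p n := by
      rw [hc]
      simp [Part.assert]
    rw [← h, Part.dom_iff_mem]
    simp only [Nat.Partrec.Code.evaln_complete, Option.isSome_iff_exists, Option.mem_def]
    exact exists_comm

theorem REPred.of_exists_primrec {p : ℕ → Prop} {Q : ℕ → ℕ → Bool} (hQ : Primrec₂ Q)
    (h : ∀ n, p n ↔ ∃ s, Q n s = true) : REPred p := by
  have hf : Primrec₂ fun n s => if Q n s = true then some () else none :=
    Primrec.ite (PrimrecRel.comp Primrec.eq hQ (Primrec.const true)) (Primrec.const _)
      (Primrec.const none)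
  refine REPred.of_eq (Partrec.rfindOpt hf.to_comp).dom_re fun n => ?_
  rw [h, Nat.rfindOpt_dom]
  simp

/-! ### Bounded runs of oracle machines -/

theorem oraclePrefix_congr {p q : ℕ → ℕ} {j : ℕ} (h : ∀ i < j, p i = q i) :
    oraclePrefix p j = oraclePrefix q j :=
  List.map_congr_left fun i hi => h i (List.mem_range.1 hi)

theorem oraclePrefix_getD {p : ℕ → ℕ} {i j : ℕ} (h : i < j) : (oraclePrefix p j).getD i 0 = p i := by
  simp [oraclePrefix, List.getD, h]

theorem oraclePrefix_length (p : ℕ → ℕ) (j : ℕ) : (oraclePrefix p j).length = j := by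
  simp [oraclePrefix]

theorem Primrec.oraclePrefix {α : Type*} [Primcodable α] {P : α → ℕ → ℕ} (hP : Primrec₂ P) :
    Primrec₂ fun a j => oraclePrefix (P a) j :=
  Primrec.list_map (Primrec.list_range.comp Primrec.snd)
    (hP.comp (Primrec.fst.comp Primrec.fst) Primrec.snd)

/-- Rewrites the unbounded search through list operations, so that its stages become primitive
recursive. -/
theorem Nat.mem_rfindOpt_iff {α : Type*} {f : ℕ → Option α} {a : α} :
    a ∈ Nat.rfindOpt f ↔ ∃ t, ((List.range t).filterMap f).head? = some a := by
  have hs : ∀ t, ((List.range t).filterMap f).head? = some a ↔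
      ∃ m < t, f m = some a ∧ ∀ k < m, f k = none := by
    intro t
    rw [List.head?_filterMap]
    induction t with
    | zero => simp
    | succ t ih =>
      rw [List.range_succ, List.findSome?_append, Option.or_eq_some_iff, ih]
      simp only [List.findSome?_eq_none_iff, List.mem_range, List.findSome?_singleton]
      constructor
      · rintro (⟨m, hm, h⟩ | ⟨h₁, h₂⟩)
        · exact ⟨m, hm.trans (Nat.lt_succ_self t), h⟩
        · exact ⟨t, Nat.lt_succ_self t, h₂, h₁⟩
      · rintro ⟨m, hm, h₁, h₂⟩
        rcases (Nat.lt_succ_iff_lt_or_eq.1 hm) with hm | rfl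
        · exact Or.inl ⟨m, hm, h₁, h₂⟩
        · exact Or.inr ⟨h₂, h₁⟩
  simp only [hs, Nat.rfindOpt, Part.mem_bind_iff, Part.mem_coe, Option.mem_def]
  constructor
  · rintro ⟨m, hm, h⟩
    refine ⟨m + 1, m, Nat.lt_succ_self m, h, fun k hk => ?_⟩
    simpa using (Nat.mem_rfind.1 hm).2 hk
  · rintro ⟨-, m, -, h₁, h₂⟩
    refine ⟨m, Nat.mem_rfind.2 ⟨?_, fun {k} hk => ?_⟩, h₁⟩
    · simp [h₁]
    · simp [h₂ k hk]

/-- The result, if any, of the first `t` runs that the machine with index `e` performs with oracle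
`p` on input `n`. -/
def oracleRun (e : ℕ) (p : ℕ → ℕ) (n t : ℕ) : Option ℕ :=
  ((List.range t).filterMap fun m =>
    Nat.Partrec.Code.evaln m.unpair.2 (Nat.Partrec.Code.ofNatCode e)
      (Nat.pair (Encodable.encode (oraclePrefix p m.unpair.1)) n)).head?

theorem mem_oracleEval_iff {e : ℕ} {p : ℕ → ℕ} {n v : ℕ} :
    v ∈ oracleEval e p n ↔ ∃ t, oracleRun e p n t = some v :=
  Nat.mem_rfindOpt_iff

/-- The use principle: run `m < t` sees an oracle segment of length `m.unpair.1 ≤ m`. -/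
theorem oracleRun_congr {e n t : ℕ} {p q : ℕ → ℕ} (h : ∀ i < t, p i = q i) :
    oracleRun e p n t = oracleRun e q n t := by
  unfold oracleRun
  congr 1
  refine List.filterMap_congr fun m hm => ?_
  rw [oraclePrefix_congr fun i hi => h i ?_]
  exact hi.trans_le ((Nat.unpair_left_le m).trans (List.mem_range.1 hm).le)

theorem Primrec.oracleRun {α : Type*} [Primcodable α] {E N T : α → ℕ} {P : α → ℕ → ℕ}
    (hE : Primrec E) (hP : Primrec₂ P) (hN : Primrec N) (hT : Primrec T) :
    Primrec fun a => oracleRun (E a) (P a) (N a) (T a) := by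
  refine Primrec.list_head?.comp (Primrec.listFilterMap (Primrec.list_range.comp hT) ?_)
  refine Nat.Partrec.Code.primrec_evaln.comp (((Primrec.snd.comp (Primrec.unpair.comp Primrec.snd)).pair
    ((Primrec.ofNat Nat.Partrec.Code).comp (hE.comp Primrec.fst))).pair
    (Primrec₂.natPair.comp (Primrec.encode.comp ?_) (hN.comp Primrec.fst)))
  exact (Primrec.oraclePrefix hP).comp Primrec.fst (Primrec.fst.comp (Primrec.unpair.comp Primrec.snd))

theorem OracleMaps.exists_run {e : ℕ} {p r : ℕ → ℕ} (h : OracleMaps e p r) (n : ℕ) :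
    ∃ t, oracleRun e p n t = some (r n) :=
  mem_oracleEval_iff.1 (h n)

theorem OracleMaps.eq_of_run {e n t v : ℕ} {p r : ℕ → ℕ} (h : OracleMaps e p r)
    (hv : oracleRun e p n t = some v) : v = r n :=
  Part.mem_unique (mem_oracleEval_iff.2 ⟨t, hv⟩) (h n)

/-- A primitive recursive rule that computes the `k`th value of the output from the initial segment
of length `N k` of the oracle is performed by a machine. -/
theorem exists_oracleMaps {N : ℕ → ℕ} {g : List ℕ → ℕ → ℕ} (hN : Primrec N) (hg : Primrec₂ g) :
    ∃ e, ∀ p, OracleMaps e p fun k => g (oraclePrefix p (N k)) k := by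
  -- Diverging on segments of any other length ensures that whichever run halts first gives the
  -- intended value.
  let F : ℕ → Option ℕ := fun z => (Encodable.decode (α := List ℕ) z.unpair.1).bind fun l =>
    if l.length = N z.unpair.2 then some (g l z.unpair.2) else none
  have hF : Primrec F := by
    have hk : Primrec fun x : ℕ × List ℕ => x.1.unpair.2 :=
      Primrec.snd.comp (Primrec.unpair.comp Primrec.fst)
    refine Primrec.option_bind
      (Primrec.decode.comp (Primrec.fst.comp Primrec.unpair)) ?_
    refine Primrec.ite (PrimrecRel.comp Primrec.eq (Primrec.list_length.comp Primrec.snd)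
      (hN.comp hk)) (Primrec.option_some.comp (hg.comp Primrec.snd hk)) (Primrec.const none)
  obtain ⟨c, hc⟩ := Nat.Partrec.Code.exists_code.1 (Partrec.nat_iff.1 hF.to_comp.ofOption)
  refine ⟨Encodable.encode c, fun p k => ?_⟩
  have hdec : Nat.Partrec.Code.ofNatCode (Encodable.encode c) = c :=
    Denumerable.ofNat_encode c
  have hval : ∀ j v, v ∈ c.eval (Nat.pair (Encodable.encode (oraclePrefix p j)) k) ↔
      j = N k ∧ g (oraclePrefix p j) k = v := by
    intro j v
    simp [hc, F, oraclePrefix_length]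
  unfold oracleEval
  rw [hdec]
  have hdom : (Nat.rfindOpt fun m => Nat.Partrec.Code.evaln m.unpair.2 c
      (Nat.pair (Encodable.encode (oraclePrefix p m.unpair.1)) k)).Dom := by
    rw [Nat.rfindOpt_dom]
    obtain ⟨s, hs⟩ := Nat.Partrec.Code.evaln_complete.1 ((hval (N k) _).2 ⟨rfl, rfl⟩)
    exact ⟨Nat.pair (N k) s, _, by simpa using hs⟩
  obtain ⟨v, hv⟩ := Part.dom_iff_mem.1 hdom
  obtain ⟨m, hm⟩ := Nat.rfindOpt_spec hv
  obtain ⟨hj, rfl⟩ := (hval _ _).1 (Nat.Partrec.Code.evaln_sound hm)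
  rwa [hj] at hv

namespace RepresentedSpace

/-! ### The space `spaceS A` -/

/-- The points of `spaceS A` correspond to the natural numbers, by the first projection. -/
def spaceSEquiv (A : Set ℕ) : (spaceS A).Pt ≃ ℕ where
  toFun x := x.1.1
  invFun n := ⟨(n, n ∈ A), by
    by_cases h : n ∈ A
    · exact Or.inl ⟨n, h, Prod.ext rfl (eq_true h)⟩
    · exact Or.inr ⟨n, h, Prod.ext rfl (eq_false h)⟩⟩
  left_inv := by
    rintro ⟨z, ⟨n, h, rfl⟩ | ⟨n, h, rfl⟩⟩
    · exact Subtype.ext (Prod.ext rfl (eq_true h))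
    · exact Subtype.ext (Prod.ext rfl (eq_false h))
  right_inv _ := rfl

theorem spaceS_isName_iff {A : Set ℕ} {p : ℕ → ℕ} {x : (spaceS A).Pt} :
    (spaceS A).IsName p x ↔
      p 0 = spaceSEquiv A x ∧ (spaceSEquiv A x ∈ A ↔ ∃ k, p (2 * k + 1) ≠ 0) := by
  obtain ⟨n, rfl⟩ := (spaceSEquiv A).symm.surjective x
  exact Iff.rfl

/-! ### Enumerability of `A` from each of the conditions -/

theorem rePred_of_computable_sequence {A : Set ℕ} {e : ℕ} {s : ℕ → (spaceS A).Pt}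
    (hs : ∀ m, ∃ r, OracleMaps e (fun _ => m) r ∧ (spaceS A).IsName r (s m))
    (hsurj : ∀ n, ∃ m, spaceSEquiv A (s m) = n) : REPred fun n => n ∈ A := by
  -- The witness `z` codes `((m, t), (k, u))`: within `t` runs the name of `s m` starts with `n`,
  -- and within `u` runs its entry `2 * k + 1` is seen to be nonzero. An unfinished run counts as 0,
  -- hence never as evidence.
  let Q : ℕ → ℕ → Bool := fun n z =>
    decide (oracleRun e (fun _ => z.unpair.1.unpair.1) 0 z.unpair.1.unpair.2 = some n) &&
    decide (0 < (oracleRun e (fun _ => z.unpair.1.unpair.1) (2 * z.unpair.2.unpair.1 + 1)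
      z.unpair.2.unpair.2).getD 0)
  have hQ : Primrec₂ Q := by
    have h₁ : Primrec fun x : ℕ × ℕ => x.2.unpair.1 :=
      Primrec.fst.comp (Primrec.unpair.comp Primrec.snd)
    have h₂ : Primrec fun x : ℕ × ℕ => x.2.unpair.2 :=
      Primrec.snd.comp (Primrec.unpair.comp Primrec.snd)
    have h₁₁ : Primrec fun x : ℕ × ℕ => x.2.unpair.1.unpair.1 :=
      Primrec.fst.comp (Primrec.unpair.comp h₁)
    have h₁₂ : Primrec fun x : ℕ × ℕ => x.2.unpair.1.unpair.2 :=
      Primrec.snd.comp (Primrec.unpair.comp h₁)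
    have h₂₁ : Primrec fun x : ℕ × ℕ => x.2.unpair.2.unpair.1 :=
      Primrec.fst.comp (Primrec.unpair.comp h₂)
    have h₂₂ : Primrec fun x : ℕ × ℕ => x.2.unpair.2.unpair.2 :=
      Primrec.snd.comp (Primrec.unpair.comp h₂)
    have hP : Primrec₂ fun (x : ℕ × ℕ) (_ : ℕ) => x.2.unpair.1.unpair.1 := h₁₁.comp Primrec.fst
    refine Primrec.and.comp ?_ ?_
    · exact PrimrecPred.decide (PrimrecRel.comp Primrec.eq
        (Primrec.oracleRun (Primrec.const e) hP (Primrec.const 0) h₁₂)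
        (Primrec.option_some.comp Primrec.fst))
    · exact PrimrecPred.decide (PrimrecRel.comp Primrec.nat_lt (Primrec.const 0)
        (Primrec.option_getD.comp (Primrec.oracleRun (Primrec.const e) hP
          (Primrec.nat_double_succ.comp h₂₁) h₂₂) (Primrec.const 0)))
  refine REPred.of_exists_primrec hQ fun n => ⟨fun hn => ?_, ?_⟩
  · obtain ⟨m, rfl⟩ := hsurj n
    obtain ⟨r, hr, hrn⟩ := hs m
    obtain ⟨h0, h1⟩ := spaceS_isName_iff.1 hrn
    obtain ⟨k, hk⟩ := h1.1 hn
    obtain ⟨t, ht⟩ := hr.exists_run 0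
    obtain ⟨u, hu⟩ := hr.exists_run (2 * k + 1)
    refine ⟨Nat.pair (Nat.pair m t) (Nat.pair k u), ?_⟩
    simp [Q, ht, hu, h0, Nat.pos_iff_ne_zero, hk]
  · rintro ⟨z, hz⟩
    simp only [Q, Bool.and_eq_true, decide_eq_true_eq] at hz
    obtain ⟨r, hr, hrn⟩ := hs z.unpair.1.unpair.1
    obtain ⟨h0, h1⟩ := spaceS_isName_iff.1 hrn
    have hn := hr.eq_of_run hz.1
    cases hv : oracleRun e (fun _ => z.unpair.1.unpair.1) (2 * z.unpair.2.unpair.1 + 1)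
      z.unpair.2.unpair.2 with
    | none => simp [hv] at hz
    | some v =>
      have hv' := hr.eq_of_run hv
      rw [hn, h0]
      refine h1.2 ⟨z.unpair.2.unpair.1, ?_⟩
      rw [← hv']
      simpa [hv, Nat.pos_iff_ne_zero] using hz.2

/-- The parameter `n` sits in the oracle part of the code, so one machine serves all `n` and the
code is computable from `n`. With `h` constantly 1 it codes the fiber over `n`; with `h` the
identity it copies the Sierpinski component there. -/
theorem exists_code_fiber {h : ℕ → ℕ} (hh : Primrec h) : ∃ e, ∀ n p,
    CodedMaps (fun i => if i = 0 then e else n) p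
      fun k => if p 0 = n then h (p (2 * k + 1)) else 0 := by
  -- In the joined oracle, position 0 holds `n`, position 1 holds `p 0`, and position `4 * k + 3 = 2
  -- * (2 * k + 1) + 1` holds `p (2 * k + 1)`.
  let g : List ℕ → ℕ → ℕ := fun l k => if l.getD 1 0 = l.getD 0 0 then h (l.getD (4 * k + 3) 0) else 0
  have h4 : Primrec fun k : ℕ => 4 * k :=
    Primrec.nat_mul.comp (Primrec.const 4) Primrec.id
  have hg : Primrec₂ g := by
    have hd : ∀ {f : List ℕ × ℕ → ℕ}, Primrec f → Primrec fun x : List ℕ × ℕ => x.1.getD (f x) 0 :=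
      fun hf => (Primrec.list_getD 0).comp Primrec.fst hf
    refine Primrec.ite (PrimrecRel.comp Primrec.eq (hd (Primrec.const 1)) (hd (Primrec.const 0)))
      (hh.comp (hd (Primrec.nat_add.comp (h4.comp Primrec.snd) (Primrec.const 3)))) (Primrec.const 0)
  obtain ⟨e, he⟩ := exists_oracleMaps (N := fun k => 4 * k + 4)
    (Primrec.nat_add.comp h4 (Primrec.const 4)) hg
  refine ⟨e, fun n p => ?_⟩
  have hk : ∀ k, g (oraclePrefix (joinSeq (fun _ => n) p) (4 * k + 4)) k =
      if p 0 = n then h (p (2 * k + 1)) else 0 := by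
    intro k
    have h1 : (4 * k + 3) % 2 = 1 := by omega
    have h2 : (4 * k + 3) / 2 = 2 * k + 1 := by omega
    simp only [g]
    rw [oraclePrefix_getD (by omega), oraclePrefix_getD (by omega), oraclePrefix_getD (by omega)]
    simp [joinSeq, h1, h2]
  have := he (joinSeq (fun _ => n) p)
  simp only [hk] at this
  exact this

theorem rePred_of_isComputablySeparable {A : Set ℕ} (h : IsComputablySeparable (spaceS A)) :
    REPred fun n => n ∈ A := by
  obtain ⟨s, ⟨e, he⟩, hd⟩ := h
  obtain ⟨c, hc⟩ := exists_code_fiber (Primrec.const 1)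
  refine rePred_of_computable_sequence (fun m => he (fun _ => m) m rfl) fun n => ?_
  let U : (opens (spaceS A)).Pt := ⟨fun x => spaceSEquiv A x = n, _, fun p x hx =>
    ⟨_, hc n p, by
      have h0 := (spaceS_isName_iff.1 hx).1
      simp [sierpinski, h0]⟩⟩
  exact hd U ⟨(spaceSEquiv A).symm n, (spaceSEquiv A).apply_symm_apply n⟩

theorem rePred_of_isOvert {A : Set ℕ} (h : IsOvert (spaceS A)) : REPred fun n => n ∈ A := by
  obtain ⟨e, he⟩ := h
  obtain ⟨c, hc⟩ := exists_code_fiber Primrec.id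
  let P : ℕ → ℕ → ℕ := fun n i => if i = 0 then c else n
  have hP : Primrec₂ P := Primrec.ite (PrimrecRel.comp Primrec.eq Primrec.snd (Primrec.const 0))
    (Primrec.const c) Primrec.fst
  -- On the fiber over `n` the name itself semidecides `n ∈ A`, so copying it realises this set; the
  -- set is non-empty exactly when `n ∈ A`.
  have hU : ∀ n, CodesRealiser (spaceS A) sierpinski (P n)
      fun x => spaceSEquiv A x = n ∧ n ∈ A := by
    intro n p x hx
    refine ⟨_, hc n p, ?_⟩
    obtain ⟨h0, h1⟩ := spaceS_isName_iff.1 hx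
    by_cases hn : spaceSEquiv A x = n
    · subst hn
      simpa [sierpinski, h0] using h1
    · simp [sierpinski, h0, hn]
  have hre : ∀ n, ∃ r, OracleMaps e (P n) r ∧ (n ∈ A ↔ ∃ k, r k ≠ 0) := by
    intro n
    obtain ⟨r, hr, hrn⟩ := he (P n) ⟨_, _, hU n⟩ (hU n)
    refine ⟨r, hr, Iff.trans ?_ hrn⟩
    exact ⟨fun hn => ⟨(spaceSEquiv A).symm n, (spaceSEquiv A).apply_symm_apply n, hn⟩,
      fun ⟨_, hx⟩ => hx.2⟩
  let Q : ℕ → ℕ → Bool := fun n z => decide (0 < (oracleRun e (P n) z.unpair.1 z.unpair.2).getD 0)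
  have hQ : Primrec₂ Q := by
    refine PrimrecPred.decide (PrimrecRel.comp Primrec.nat_lt (Primrec.const 0)
      (Primrec.option_getD.comp (Primrec.oracleRun (P := fun x : ℕ × ℕ => P x.1) (Primrec.const e)
      (hP.comp (Primrec.fst.comp Primrec.fst) Primrec.snd)
      (Primrec.fst.comp (Primrec.unpair.comp Primrec.snd))
      (Primrec.snd.comp (Primrec.unpair.comp Primrec.snd))) (Primrec.const 0)))
  refine REPred.of_exists_primrec hQ fun n => ?_
  obtain ⟨r, hr, hn⟩ := hre n
  rw [hn]
  constructor
  · rintro ⟨k, hk⟩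
    obtain ⟨t, ht⟩ := hr.exists_run k
    exact ⟨Nat.pair k t, by simp [Q, ht, Nat.pos_iff_ne_zero, hk]⟩
  · rintro ⟨z, hz⟩
    refine ⟨z.unpair.1, ?_⟩
    cases hv : oracleRun e (P n) z.unpair.1 z.unpair.2 with
    | none => simp [Q, hv] at hz
    | some v =>
      rw [← hr.eq_of_run hv]
      simpa [Q, hv, Nat.pos_iff_ne_zero] using hz

theorem isComputablySeparable_of_iso {X : RepresentedSpace} (h : Iso X natSpace) :
    IsComputablySeparable X := by
  obtain ⟨f, -, hf⟩ := h
  exact ⟨f.symm, hf, fun U ⟨x, hx⟩ => ⟨f x, by rwa [f.symm_apply_apply]⟩⟩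

/-- The constant sequence `m` names `a m`, so the inverse isomorphism turns the dense sequence into
a computable one. It hits every point because the first coordinate depends on finitely many entries
of a name, hence is locally constant. -/
theorem rePred_of_iso_completionSpace {A : Set ℕ} {E : Type} [PseudoMetricSpace E] {a : ℕ → E}
    {ha : DenseRange a} (h : Iso (spaceS A) (completionSpace E a ha)) : REPred fun n => n ∈ A := by
  obtain ⟨f, -, e, he⟩ := h
  have hd : DenseRange fun m => (a m : UniformSpace.Completion E) :=
    UniformSpace.Completion.denseRange_coe.comp ha (UniformSpace.Completion.continuous_coe E)
  refine rePred_of_computable_sequence (e := e)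
    (s := fun m => f.symm (a m : UniformSpace.Completion E)) (fun m => he _ _ fun n => ?_)
    fun n => ?_
  · rw [dist_self]
    positivity
  · let x : UniformSpace.Completion E := f ((spaceSEquiv A).symm n)
    obtain ⟨p, hp⟩ := (completionSpace E a ha).surj x
    obtain ⟨r, hr, hrx⟩ := he p x hp
    have hrn : r 0 = n := by
      rw [(spaceS_isName_iff.1 hrx).1]
      exact (congrArg _ (f.symm_apply_apply _)).trans ((spaceSEquiv A).apply_symm_apply n)
    obtain ⟨t, ht⟩ := hr.exists_run 0
    -- The strict inequalities make the set of points with a name extending the first `t` entries of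
    -- `p` contain a neighbourhood of `x`.
    have hopen : IsOpen {y : UniformSpace.Completion E | ∀ i ∈ Finset.range t,
        dist (a (p i) : UniformSpace.Completion E) y < (1 / 2) ^ i} := by
      simp only [Set.ofPred_forall]
      exact isOpen_biInter_finset fun i _ =>
        isOpen_lt (continuous_const.dist continuous_id) continuous_const
    obtain ⟨m, hm⟩ := hd.exists_mem_open hopen ⟨x, fun i _ => hp i⟩
    refine ⟨m, ?_⟩
    -- A name of `a m` sharing with `p` all that the run producing `n` has read.
    let q : ℕ → ℕ := fun i => if i < t then p i else m
    have hq : (completionSpace E a ha).IsName q (a m : UniformSpace.Completion E) := by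
      intro i
      by_cases hi : i < t
      · simpa [q, hi] using hm i (Finset.mem_range.2 hi)
      · simp [q, hi]
    obtain ⟨r', hr', hrm⟩ := he q _ hq
    rw [← (spaceS_isName_iff.1 hrm).1, ← hrn]
    refine (hr'.eq_of_run (t := t) ?_).symm
    rw [← ht]
    exact oracleRun_congr fun i hi => by simp [q, hi]

/-! ### Consequences of enumerability -/

/-- Names of the points of `spaceS A`, where `Q` enumerates `A`. -/
def spaceSName (Q : ℕ → ℕ → Bool) (n i : ℕ) : ℕ :=
  if i % 2 = 0 then n else (Q n (i / 2)).toNat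

theorem primrec_spaceSName {Q : ℕ → ℕ → Bool} (hQ : Primrec₂ Q) : Primrec₂ (spaceSName Q) := by
  have h2 : Primrec fun x : ℕ × ℕ => x.2 / 2 :=
    Primrec.nat_div.comp Primrec.snd (Primrec.const 2)
  refine Primrec.ite (PrimrecRel.comp Primrec.eq
    (Primrec.nat_mod.comp Primrec.snd (Primrec.const 2)) (Primrec.const 0)) Primrec.fst ?_
  exact ((Primrec.dom_bool Bool.toNat).comp (hQ.comp Primrec.fst h2))

theorem isName_spaceSName {A : Set ℕ} {Q : ℕ → ℕ → Bool} (h : ∀ n, n ∈ A ↔ ∃ s, Q n s = true)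
    (n : ℕ) : (spaceS A).IsName (spaceSName Q n) ((spaceSEquiv A).symm n) := by
  rw [spaceS_isName_iff, Equiv.apply_symm_apply, h]
  refine ⟨rfl, exists_congr fun k => ?_⟩
  have h1 : (2 * k + 1) % 2 = 1 := by omega
  have h2 : (2 * k + 1) / 2 = k := by omega
  simp [spaceSName, h1, h2]

/-- The hypotheses on `X` make it a copy of ℕ: the first entry of a name determines the point, and a
constant name can be written down from it. Enumerability of `A` is needed only for the map back. -/
theorem iso_spaceS_of_rePred {A : Set ℕ} (hA : REPred fun n => n ∈ A) {X : RepresentedSpace}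
    (f : ℕ ≃ X.Pt) (hname : ∀ p n, X.IsName p (f n) → p 0 = n)
    (hconst : ∀ n, X.IsName (fun _ => n) (f n)) : Iso (spaceS A) X := by
  obtain ⟨Q, hQ, hQA⟩ := hA.exists_primrec
  have hd : Primrec fun l : List ℕ => l.getD 0 0 :=
    (Primrec.list_getD 0).comp Primrec.id (Primrec.const 0)
  refine ⟨(spaceSEquiv A).trans f, ?_, ?_⟩
  · obtain ⟨e, he⟩ := exists_oracleMaps (N := fun _ => 1) (g := fun l _ => l.getD 0 0)
      (Primrec.const 1) (hd.comp Primrec.fst)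
    refine ⟨e, fun p x hx => ⟨_, he p, ?_⟩⟩
    simp only [oraclePrefix_getD Nat.zero_lt_one, (spaceS_isName_iff.1 hx).1]
    exact hconst _
  · obtain ⟨e, he⟩ := exists_oracleMaps (N := fun _ => 1)
      (g := fun l k => spaceSName Q (l.getD 0 0) k) (Primrec.const 1)
      ((primrec_spaceSName hQ).comp (hd.comp Primrec.fst) Primrec.snd)
    refine ⟨e, fun p x hx => ⟨_, he p, ?_⟩⟩
    obtain ⟨n, rfl⟩ := f.surjective x
    simp only [oraclePrefix_getD Nat.zero_lt_one, hname p n hx]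
    simpa using isName_spaceSName hQA n

theorem iso_natSpace_of_rePred {A : Set ℕ} (hA : REPred fun n => n ∈ A) :
    Iso (spaceS A) natSpace :=
  iso_spaceS_of_rePred hA (Equiv.refl ℕ) (fun _ _ h => h) fun _ => rfl

theorem iso_completionSpace_of_rePred {A : Set ℕ} (hA : REPred fun n => n ∈ A) {E : Type}
    [MetricSpace E] [CompleteSpace E] {a : ℕ → E} {ha : DenseRange a} (hb : Function.Bijective a)
    (hdist : ∀ m n, m ≠ n → 1 ≤ dist (a m) (a n)) : Iso (spaceS A) (completionSpace E a ha) := by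
  -- A complete space has closed as well as dense image in its completion.
  have hc : Function.Bijective ((↑) : E → UniformSpace.Completion E) := by
    refine ⟨UniformSpace.Completion.coe_injective E, Set.range_eq_univ.1 ?_⟩
    rw [← (UniformSpace.Completion.isUniformEmbedding_coe E).isClosedEmbedding.isClosed_range.closure_eq]
    exact UniformSpace.Completion.denseRange_coe.closure_range
  refine iso_spaceS_of_rePred hA (Equiv.ofBijective _ (hc.comp hb)) (fun p n h => ?_) fun n k => ?_
  · have h0 : dist (a (p 0) : UniformSpace.Completion E) (a n) < (1 / 2) ^ 0 := h 0
    rw [UniformSpace.Completion.dist_eq, pow_zero] at h0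
    by_contra hne
    exact h0.not_ge (hdist _ _ hne)
  · show dist (a n : UniformSpace.Completion E) (a n) < (1 / 2) ^ k
    rw [dist_self]
    positivity

theorem isCompleteComputableMetricSpace_of_rePred {A : Set ℕ} (hA : REPred fun n => n ∈ A) :
    IsCompleteComputableMetricSpace (spaceS A) := by
  -- The instance is the usual distance on ℕ.
  refine ⟨inferInstance, ?_, ?_⟩
  · let g : List ℕ → ℕ → ℕ := fun l _ =>
      -- One of the two truncated differences is 0, so their sum is the exact distance, coded as a
      -- rational with denominator 1.
      Nat.pair (Nat.pair ((l.getD 0 0 - l.getD 1 0) + (l.getD 1 0 - l.getD 0 0)) 0) 0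
    have hg : Primrec₂ g := by
      have hd : ∀ i, Primrec fun x : List ℕ × ℕ => x.1.getD i 0 :=
        fun i => (Primrec.list_getD 0).comp Primrec.fst (Primrec.const i)
      exact Primrec₂.natPair.comp (Primrec₂.natPair.comp (Primrec.nat_add.comp
        (Primrec.nat_sub.comp (hd 0) (hd 1)) (Primrec.nat_sub.comp (hd 1) (hd 0)))
        (Primrec.const 0)) (Primrec.const 0)
    obtain ⟨e, he⟩ := exists_oracleMaps (N := fun _ => 2) (Primrec.const 2) hg
    refine ⟨e, fun p z hz => ⟨_, he p, ?_⟩⟩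
    obtain ⟨m, n⟩ := z
    obtain ⟨hm, hn⟩ : p 0 = m ∧ p 1 = n := hz
    subst hm hn
    intro k
    have hdist : (ratOfNat (g (oraclePrefix p 2) k) : ℝ) = dist (p 0) (p 1) := by
      simp only [g, oraclePrefix_getD (show 0 < 2 by omega),
        oraclePrefix_getD (show 1 < 2 by omega), ratOfNat, Nat.unpair_pair]
      rw [Nat.dist_eq]
      rcases le_total (p 0) (p 1) with h | h
      · rw [abs_of_nonpos (sub_nonpos.2 (Nat.cast_le.2 h)), Nat.sub_eq_zero_of_le h]
        push_cast [h]
        ring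
      · rw [abs_of_nonneg (sub_nonneg.2 (Nat.cast_le.2 h)), Nat.sub_eq_zero_of_le h]
        push_cast [h]
        ring
    show |(ratOfNat (g (oraclePrefix p 2) k) : ℝ) - dist (p 0) (p 1)| < _
    rw [hdist, sub_self, abs_zero]
    positivity
  · exact iso_completionSpace_of_rePred hA Function.bijective_id fun m n h =>
      Nat.pairwise_one_le_dist h

/-- Directedness under equality forces an ideal to be a singleton, so its only name is constant. -/
theorem iso_idealSpace_eq_of_rePred {A : Set ℕ} (hA : REPred fun n => n ∈ A) :
    Iso (spaceS A) (idealSpace Eq) := by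
  have hI : ∀ n : ℕ, IsIdeal Eq ({n} : Set ℕ) := fun n =>
    ⟨⟨n, rfl⟩, fun x y hy h => h.trans hy, fun x hx y hy => ⟨n, rfl, hx, hy⟩⟩
  let f : ℕ → (idealSpace Eq).Pt := fun n => ⟨{n}, hI n⟩
  have hf : Function.Bijective f := by
    refine ⟨fun m n h => Set.singleton_injective (congrArg Subtype.val h), ?_⟩
    rintro ⟨I, ⟨n, hn⟩, -, h⟩
    refine ⟨n, Subtype.ext (Set.eq_singleton_iff_unique_mem.2 ⟨hn, fun m hm => ?_⟩).symm⟩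
    obtain ⟨z, -, h1, h2⟩ := h m hm n hn
    exact h1.trans h2.symm
  refine iso_spaceS_of_rePred hA (Equiv.ofBijective f hf) (fun p n h => ?_) fun n => ?_
  · have h' : ({n} : Set ℕ) = Set.range p := h
    have h0 : p 0 ∈ ({n} : Set ℕ) := h' ▸ Set.mem_range_self 0
    exact h0
  · exact (Set.range_const (ι := ℕ) (c := n)).symm

/-- Dovetailing: output `k`, coding `(n, (i, t))`, is entry `i` of the realiser's answer on the
computable name of the point over `n`, if found within `t` runs, and 0 otherwise. -/
theorem isOvert_of_rePred {A : Set ℕ} (hA : REPred fun n => n ∈ A) : IsOvert (spaceS A) := by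
  obtain ⟨Q, hQ, hQA⟩ := hA.exists_primrec
  let P : (ℕ → ℕ) → ℕ → ℕ → ℕ := fun c n => joinSeq (fun i => c (i + 1)) (spaceSName Q n)
  let g : List ℕ → ℕ → ℕ := fun l k =>
    (oracleRun (l.getD 0 0) (P (fun i => l.getD i 0) k.unpair.1) k.unpair.2.unpair.1
      k.unpair.2.unpair.2).getD 0
  have hg : Primrec₂ g := by
    have h₁ : Primrec fun x : List ℕ × ℕ => x.2.unpair.1 :=
      Primrec.fst.comp (Primrec.unpair.comp Primrec.snd)
    have h₂ : Primrec fun x : List ℕ × ℕ => x.2.unpair.2 :=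
      Primrec.snd.comp (Primrec.unpair.comp Primrec.snd)
    have hhalf : Primrec fun y : (List ℕ × ℕ) × ℕ => y.2 / 2 :=
      Primrec.nat_div.comp Primrec.snd (Primrec.const 2)
    refine Primrec.option_getD.comp (Primrec.oracleRun
      (P := fun x : List ℕ × ℕ => P (fun i => x.1.getD i 0) x.2.unpair.1)
      ((Primrec.list_getD 0).comp Primrec.fst (Primrec.const 0)) ?_
      (Primrec.fst.comp (Primrec.unpair.comp h₂)) (Primrec.snd.comp (Primrec.unpair.comp h₂)))
      (Primrec.const 0)
    refine Primrec.ite (PrimrecRel.comp Primrec.eq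
      (Primrec.nat_mod.comp Primrec.snd (Primrec.const 2)) (Primrec.const 0)) ?_ ?_
    · exact (Primrec.list_getD 0).comp (Primrec.fst.comp Primrec.fst) (Primrec.succ.comp hhalf)
    · exact (primrec_spaceSName hQ).comp (h₁.comp Primrec.fst) hhalf
  -- Since `t ≤ k`, these runs read the code `c` only at 0 and at positions `i / 2 + 1` with `i <
  -- k`, all below `k + 2`.
  obtain ⟨e, he⟩ := exists_oracleMaps (N := fun k => k + 2)
    (Primrec.succ.comp Primrec.succ) hg
  refine ⟨e, fun c U hU => ⟨_, he c, ?_⟩⟩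
  have hrun : ∀ k, g (oraclePrefix c (k + 2)) k = (oracleRun (c 0) (P c k.unpair.1)
      k.unpair.2.unpair.1 k.unpair.2.unpair.2).getD 0 := by
    intro k
    simp only [g]
    rw [oraclePrefix_getD (by omega)]
    congr 1
    refine oracleRun_congr fun i hi => ?_
    have hk : k.unpair.2.unpair.2 ≤ k := (Nat.unpair_right_le _).trans (Nat.unpair_right_le _)
    simp only [P, joinSeq]
    rw [oraclePrefix_getD (by omega)]
  have hreal : ∀ n, ∃ r, OracleMaps (c 0) (P c n) r ∧
      (MemOpen ((spaceSEquiv A).symm n) U ↔ ∃ k, r k ≠ 0) := fun n =>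
    hU _ _ (isName_spaceSName hQA n)
  show (∃ x, MemOpen x U) ↔ ∃ k, g (oraclePrefix c (k + 2)) k ≠ 0
  simp only [hrun]
  constructor
  · rintro ⟨x, hx⟩
    obtain ⟨n, rfl⟩ := (spaceSEquiv A).symm.surjective x
    obtain ⟨r, hr, hn⟩ := hreal n
    obtain ⟨i, hi⟩ := hn.1 hx
    obtain ⟨t, ht⟩ := hr.exists_run i
    exact ⟨Nat.pair n (Nat.pair i t), by simpa [ht] using hi⟩
  · rintro ⟨k, hk⟩
    refine ⟨(spaceSEquiv A).symm k.unpair.1, ?_⟩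
    obtain ⟨r, hr, hn⟩ := hreal k.unpair.1
    refine hn.2 ⟨k.unpair.2.unpair.1, ?_⟩
    cases hv : oracleRun (c 0) (P c k.unpair.1) k.unpair.2.unpair.1 k.unpair.2.unpair.2 with
    | none => simp [hv] at hk
    | some v =>
      rw [← hr.eq_of_run hv]
      simpa [hv] using hk

theorem isComputablyQuasiPolish_of_rePred {A : Set ℕ} (hA : REPred fun n => n ∈ A) :
    IsComputablyQuasiPolish (spaceS A) :=
  ⟨⟨Eq, fun _ _ _ => Eq.trans,
    ComputablePred.to_re (Primrec.eq (α := ℕ)).computablePred, iso_idealSpace_eq_of_rePred hA⟩,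
    isOvert_of_rePred hA⟩

end RepresentedSpace

theorem proposition22 (A : Set ℕ) :
    List.TFAE [
      RepresentedSpace.Iso (RepresentedSpace.spaceS A) RepresentedSpace.natSpace,
      RepresentedSpace.IsCompleteComputableMetricSpace (RepresentedSpace.spaceS A),
      RepresentedSpace.IsComputablyQuasiPolish (RepresentedSpace.spaceS A),
      RepresentedSpace.IsComputablySeparable (RepresentedSpace.spaceS A),
      RepresentedSpace.IsOvert (RepresentedSpace.spaceS A),
      REPred (fun n : ℕ => n ∈ A)] := by
  tfae_have 6 → 1 := RepresentedSpace.iso_natSpace_of_rePred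
  tfae_have 6 → 2 := RepresentedSpace.isCompleteComputableMetricSpace_of_rePred
  tfae_have 6 → 3 := RepresentedSpace.isComputablyQuasiPolish_of_rePred
  tfae_have 1 → 4 := RepresentedSpace.isComputablySeparable_of_iso
  tfae_have 3 → 5 := And.right
  tfae_have 4 → 6 := RepresentedSpace.rePred_of_isComputablySeparable
  tfae_have 2 → 6 := fun ⟨_, _, h⟩ => RepresentedSpace.rePred_of_iso_completionSpace h
  tfae_have 5 → 6 := RepresentedSpace.rePred_of_isOvert
  tfae_finish
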